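/- Let $\Sigma=\{0,1,\$\}$ and, for $n\in\mathbb N$, let $L_n\subseteq\{0,1\}^*\$$ be the set of finite words $u\,1\,v\,\$$ with $u,v\in\{0,1\}^*$ and $|v|+1=n$ (that is, the $n$-th letter before $\$$ is $1$). Put $$L_n^r=\{w x \mid w\in L_n,\ x\in\Sigma^\omega\},\qquad L_n^s=\{w\$^\omega \mid w\in L_n\}\cup\{0,1\}^\omega .$$ A nondeterministic Büchi automaton $\mathcal A=(\Sigma,Q,q_0,\delta,F)$ with finite $Q$ and $\delta:Q\times\Sigma\to 2^Q$ recognises the set of $\omega$-words that have a run from $q_0$ visiting some state of $F$ infinitely often. It is good-for-MDPs (GfM) if, for every finite MDP $\mathcal M$ with transitions labelled by $\Sigma$ and every initial state $s_0$, the following two numbers coincide: (a) the supremum, over all strategies for $\mathcal M$, of the probability that the label sequence of the run from $s_0$ is accepted by $\mathcal A$; (b) the supremum, over all strategies for the product $\mathcal M\times\mathcal A$, of the probability that the run from $(s_0,q_0)$ visits some $(s,q)$ with $q\in F$ infinitely often. In the product, the player chooses, besides the actions of $\mathcal M$, the successor $q'\in\delta(q,\sigma)$ of the automaton state $q$ on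 the emitted label $\sigma$ (the choice may depend on $\sigma$ and on the history, but not on the future). Strategies may be randomised and history-dependent. **Theorem.** Let $n\in\mathbb N$ and let $\mathcal A$ be a GfM automaton that recognises $L_n^r$ or $L_n^s$. Then $\mathcal A$ has at least $2^n$ states. If moreover $n>0$, then $\mathcal A$ has at least $2^n$ states even when sinks (accepting or rejecting), i.e. states $q$ with $\delta(q,\sigma)=\{q\}$ for all $\sigma\in\Sigma$, are not counted. -/

import Mathlib

open Filter MeasureTheory ProbabilityTheory
open scoped NNReal ENNReal

namespace GfM

/-! ### Words and nondeterministic Büchi automata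

Finite words over `α` are elements of `List α`, `ω`-words are functions `ℕ → α`. -/

/-- The concatenation `w x` of a finite word `w` and an `ω`-word `x`. -/
def concat {α : Type*} (w : List α) (x : ℕ → α) : ℕ → α :=
  fun i => if h : i < w.length then w[i] else x (i - w.length)

/-- A nondeterministic Büchi word automaton with alphabet `Λ` and set of states `Q`. -/
structure NBA (Λ Q : Type*) where
  /-- the initial state -/
  init : Q
  /-- the transition function -/
  trans : Q → Λ → Set Q
  /-- the set of final states -/
  final : Set Q

namespace NBA

variable {Λ Q : Type*} (A : NBA Λ Q)

/-- `ρ` is (the state sequence of) a run of the automaton on the `ω`-word `w`. -/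
def IsRun (w : ℕ → Λ) (ρ : ℕ → Q) : Prop :=
  ρ 0 = A.init ∧ ∀ i, ρ (i + 1) ∈ A.trans (ρ i) (w i)

/-- The Büchi condition: some final state occurs infinitely often. -/
def Buchi (ρ : ℕ → Q) : Prop :=
  ∃ q ∈ A.final, ∃ᶠ i in atTop, ρ i = q

/-- The set of `ω`-words that have an accepting run. -/
def language : Set (ℕ → Λ) :=
  {w | ∃ ρ, A.IsRun w ρ ∧ A.Buchi ρ}

/-- A state is a sink if every letter leads from it to itself and nowhere else. It is an accepting
sink if it is also final, and a rejecting sink otherwise. -/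
def IsSink (q : Q) : Prop :=
  ∀ a, A.trans q a = {q}

end NBA

/-! ### Markov decision processes -/

/-- A transition-labelled Markov decision process with states `S`, actions `Act` and labels `Λ`.
The transition function is the partial function with domain `Enabled` that sends `(s, m, a)` to the
subdistribution `prob s m a` on `S`; outside the domain, `prob` is zero. For a fixed state and
action, the total mass over all labels is at most one, the missing mass being the probability that
the process stops. Every state has an available action. -/
structure MDP (S Act Λ : Type*) [Fintype S] [Fintype Λ] where
  Enabled : S → Act → Λ → Prop
  prob : S → Act → Λ → S → ℝ≥0
  prob_eq_zero : ∀ s m a s', ¬ Enabled s m a → prob s m a s' = 0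
  sum_le_one : ∀ s m, ∑ x : Λ × S, prob s m x.1 x.2 ≤ 1
  exists_enabled : ∀ s, ∃ m a, Enabled s m a

/-- A step of a run: the chosen action, the label that is emitted, and the state reached. -/
abbrev Move (S Act Λ : Type*) := Act × Λ × S

/-- A step, or `none` if the process has stopped. -/
abbrev Outcome (S Act Λ : Type*) := Option (Move S Act Λ)

instance (S Act Λ : Type*) : MeasurableSpace (Outcome S Act Λ) := ⊤

instance (S Act Λ : Type*) : DiscreteMeasurableSpace (Outcome S Act Λ) := ⟨fun _ => trivial⟩

/-- The last state of the finite run that starts in `s` and makes the steps `h`. -/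
def lastState {S Act Λ : Type*} (s : S) (h : List (Move S Act Λ)) : S :=
  (h.getLast?).elim s (fun x => x.2.2)

namespace MDP

variable {S Act Λ : Type*} [Fintype S] [Fintype Λ] (M : MDP S Act Λ)

/-- The action `m` is available in the state `s`. -/
def Available (s : S) (m : Act) : Prop := ∃ a, M.Enabled s m a

/-- A (randomised, history-dependent) strategy: it maps a finite run, given by its first state and
the list of its steps, to a distribution on the actions available in its last state. -/
structure Strategy where
  act : S → List (Move S Act Λ) → PMF Act
  available : ∀ s h m, m ∈ (act s h).support → M.Available (lastState s h) m

/-- The distribution of label and successor when `m` is played in `s`; `none` gets the missing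
mass. -/
noncomputable def stepDist (s : S) (m : Act) : PMF (Option (Λ × S)) :=
  PMF.ofFintype
    (fun o => o.elim (((1 - ∑ x : Λ × S, M.prob s m x.1 x.2 : ℝ≥0)) : ℝ≥0∞)
      (fun x => (M.prob s m x.1 x.2 : ℝ≥0∞)))
    (by
      rw [Fintype.sum_option]
      simp only [Option.elim]
      rw [← ENNReal.ofNNReal_finsetSum, ← ENNReal.coe_add, tsub_add_cancel_of_le (M.sum_le_one s m),
        ENNReal.coe_one])

variable {M}

/-- The distribution of the next step after the finite run with first state `s` and steps `h`. -/
noncomputable def Strategy.next (μ : M.Strategy) (s : S) (h : List (Move S Act Λ)) :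
    PMF (Outcome S Act Λ) :=
  (μ.act s h).bind fun m =>
    (M.stepDist (lastState s h) m).map (Option.map fun x => (m, x))

open Classical in
/-- The distribution of step number `n + 1` given the steps with numbers `0, …, n`. A process that
has stopped remains stopped. -/
noncomputable def Strategy.kernel [Finite Act] (μ : M.Strategy) (s : S) (n : ℕ) :
    Kernel ((_ : Finset.Iic n) → Outcome S Act Λ) (Outcome S Act Λ) :=
  Kernel.ofFunOfCountable fun x =>
    (if x ⟨n, Finset.mem_Iic.2 le_rfl⟩ = none then PMF.pure none
     else μ.next s (List.reduceOption (List.ofFn fun i : Fin (n + 1) =>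
      x ⟨i, Finset.mem_Iic.2 (Nat.lt_succ_iff.1 i.2)⟩))).toMeasure

instance [Finite Act] (μ : M.Strategy) (s : S) (n : ℕ) : IsMarkovKernel (μ.kernel s n) :=
  ⟨fun _ => by
    unfold Strategy.kernel
    exact PMF.toMeasure.isProbabilityMeasure _⟩

/-- The probability measure on the runs from `s` under the strategy `μ`. A run is represented by its
sequence of steps. -/
noncomputable def Strategy.measure [Finite Act] (μ : M.Strategy) (s : S) :
    Measure (ℕ → Outcome S Act Λ) :=
  Kernel.trajMeasure (X := fun _ => Outcome S Act Λ) (μ.next s []).toMeasure (μ.kernel s)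

end MDP

/-! ### Product, satisfaction probabilities, good-for-MDPs automata -/

namespace NBA

variable {Λ Q : Type*} [Fintype Λ] [Fintype Q] (A : NBA Λ Q)

open Classical in
/-- The product of an MDP and an automaton. An action of the product is an action `m` of the MDP
together with, for each label `a` that may be emitted, the state `f a` to which the automaton is to
move on reading `a`; a choice that is not an `a`-successor of the current state of the automaton
blocks. -/
noncomputable def product {S Act : Type*} [Fintype S] (M : MDP S Act Λ) :
    MDP (S × Q) (Act × (Λ → Q)) Λ where
  Enabled x u a := M.Enabled x.1 u.1 a
  prob x u a y :=
    if y.2 = u.2 a ∧ y.2 ∈ A.trans x.2 a then M.prob x.1 u.1 a y.1 else 0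
  prob_eq_zero := by
    intro x u a y h
    simp [M.prob_eq_zero _ _ _ y.1 h]
  sum_le_one := by
    intro x u
    refine le_trans ?_ (M.sum_le_one x.1 u.1)
    rw [Fintype.sum_prod_type, Fintype.sum_prod_type]
    refine Finset.sum_le_sum fun a _ => ?_
    rw [Fintype.sum_prod_type]
    refine Finset.sum_le_sum fun s _ => ?_
    rw [Finset.sum_eq_single (u.2 a)]
    · dsimp only
      split_ifs
      · exact le_rfl
      · exact zero_le
    · intro q _ hq
      simp [hq]
    · simp
  exists_enabled := by
    intro x
    obtain ⟨m, a, h⟩ := M.exists_enabled x.1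
    exact ⟨(m, fun _ => A.init), a, h⟩

/-- The semantic satisfaction probability: the supremum, over the strategies for the MDP, of the
probability that the run is infinite and its label sequence is in the language of `A`. -/
noncomputable def PSem {S Act : Type*} [Fintype S] [Finite Act] (M : MDP S Act Λ) (s₀ : S) :
    ℝ≥0∞ :=
  ⨆ μ : M.Strategy, μ.measure s₀
    {ω | ∃ r : ℕ → Move S Act Λ, (∀ i, ω i = some (r i)) ∧ (fun i => (r i).2.1) ∈ A.language}

/-- The syntactic satisfaction probability: the supremum, over the strategies for the product, of
the probability that the run is infinite and satisfies the Büchi condition of the product, i.e.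
visits some `(s, q)` with `q` final infinitely often. -/
noncomputable def PSyn {S Act : Type*} [Fintype S] [Finite Act] (M : MDP S Act Λ) (s₀ : S) :
    ℝ≥0∞ :=
  ⨆ μ : (A.product M).Strategy, μ.measure (s₀, A.init)
    {ω | ∃ r : ℕ → Move (S × Q) (Act × (Λ → Q)) Λ, (∀ i, ω i = some (r i)) ∧
      ∃ x : S × Q, x.2 ∈ A.final ∧ ∃ᶠ i in atTop, (r i).2.2 = x}

/-- `A` is good for MDPs: for every finite MDP with an initial state, the syntactic and the semantic
satisfaction probability agree. -/
def GoodForMDPs : Prop :=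
  ∀ (S Act : Type) [Fintype S] [Finite Act] (M : MDP S Act Λ) (s₀ : S),
    A.PSyn M s₀ = A.PSem M s₀

end NBA

/-! ### The languages -/

/-- The alphabet `{0, 1, $}`. -/
inductive Letter where
  | zero
  | one
  | dollar
  deriving DecidableEq

instance : Fintype Letter where
  elems := {.zero, .one, .dollar}
  complete := by intro a; cases a <;> decide

/-- The letter is one of `0`, `1`. -/
def Letter.IsBit (a : Letter) : Prop := a = .zero ∨ a = .one

/-- The finite words `w ∈ {0,1}*$` in which the `n`-th letter before `$` is `1`. -/
def lang (n : ℕ) : Set (List Letter) :=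
  {w | ∃ u v : List Letter, (∀ a ∈ u, a.IsBit) ∧ (∀ a ∈ v, a.IsBit) ∧ v.length + 1 = n ∧
    w = u ++ [Letter.one] ++ v ++ [Letter.dollar]}

/-- The reachability language `{w x | w ∈ lang n, x ∈ {0,1,$}^ω}`. -/
def langR (n : ℕ) : Set (ℕ → Letter) :=
  {y | ∃ w ∈ lang n, ∃ x : ℕ → Letter, y = concat w x}

/-- The safety language `{w $^ω | w ∈ lang n} ∪ {0,1}^ω`. -/
def langS (n : ℕ) : Set (ℕ → Letter) :=
  {y | ∃ w ∈ lang n, y = concat w (fun _ => Letter.dollar)} ∪ {y | ∀ i, (y i).IsBit}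

end GfM

/-! After reading `u ∈ {0,1}^n`, an automaton that has to resolve its choices without seeing the
future must remember all of `u`, since any letter of `u` may turn out to be the decisive one.
Suppose `u` is followed by `1^j$^ω` with `j ≤ n`. The `$` first appears at position `n + j`, so
membership depends on the letter at position `j`: this is `u_j` if `j < n`, and `1` if `j = n`.

For `n > 0` and fixed `u`, let `K` be the set of those `j ≤ n` that give a word of the language. A
Markov chain emits `u`, draws `j ∈ K` uniformly, and emits `1^j$^ω`. Its semantic value is `1`. In
the product, the automaton state after `u` is fixed before `j` is known. If every such state failed
on some `j ∈ K`, each strategy would lose at least `1/|K|`, so the syntactic value would be below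
`1` (`PSyn_chain_le`). Goodness for MDPs therefore yields a state `q_u`, reachable on `u`, that
accepts `1^j$^ω` for every `j ∈ K` (`exists_reaches_acceptsFrom`).

These states are distinct: if `u_i = 1`, `u'_i = 0` and `q_u = q_u'`, the automaton would accept `u'
1^i $^ω`. None is a sink: a sink accepting `1^n$^ω` also accepts `0^n$^ω`, but `u 0^n $^ω` is not in
the language. Ending every test word in `$^ω` lets one argument serve both languages. -/

namespace GfM

/-! ### Bounding probabilities of events one step at a time. -/

namespace MDP

variable {S Act Λ : Type*}

/-- The steps among the first `t` outcomes. -/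
def history (t : ℕ) (ω : ℕ → Outcome S Act Λ) : List (Move S Act Λ) :=
  List.reduceOption (List.ofFn fun i : Fin t => ω i)

/-- The state reached after `t` steps of an infinite run from `s`. -/
def stateAt (s : S) (r : ℕ → Move S Act Λ) : ℕ → S
  | 0 => s
  | t + 1 => (r t).2.2

theorem lastState_history (s : S) {ω : ℕ → Outcome S Act Λ} {r : ℕ → Move S Act Λ}
    (hr : ∀ i, ω i = some (r i)) (t : ℕ) : lastState s (history t ω) = stateAt s r t := by
  have h : history t ω = List.ofFn fun i : Fin t => r i := by
    have : (List.ofFn fun i : Fin t => ω i) = (List.ofFn fun i : Fin t => r i).map some := by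
      simp [List.map_ofFn, hr, Function.comp_def]
    rw [history, this, List.reduceOption, List.filterMap_map]
    simp
  rw [h]
  cases t with
  | zero => simp [lastState, stateAt]
  | succ t => rw [List.ofFn_succ']; simp [lastState, stateAt]

variable [Fintype S] [Fintype Λ] {M : MDP S Act Λ}

/-- A randomised choice averages over the available actions, so a bound valid for each of them
survives. -/
theorem Strategy.next_le (μ : M.Strategy) (s : S) (h : List (Move S Act Λ))
    (G : Set (Outcome S Act Λ)) (c : ℝ≥0∞)
    (hc : ∀ m, M.Available (lastState s h) m →
      (M.stepDist (lastState s h) m).toOuterMeasure {x | x.map (fun y => (m, y)) ∈ G} ≤ c) :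
    (μ.next s h).toMeasure G ≤ c := by
  rw [PMF.toMeasure_apply_eq_toOuterMeasure_apply _ (MeasurableSet.of_discrete), Strategy.next,
    PMF.toOuterMeasure_bind_apply]
  calc ∑' m, μ.act s h m * _ ≤ ∑' m, μ.act s h m * c := by
        refine ENNReal.tsum_le_tsum fun m => ?_
        by_cases hm : m ∈ (μ.act s h).support
        · gcongr
          rw [PMF.toOuterMeasure_map_apply]
          exact hc m (μ.available s h m hm)
        · rw [PMF.mem_support_iff, not_not] at hm
          simp [hm]
    _ = c := by rw [ENNReal.tsum_mul_right, PMF.tsum_coe, one_mul]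

variable [Finite Act]

instance (μ : M.Strategy) (s : S) : IsProbabilityMeasure (μ.measure s) := by
  unfold Strategy.measure
  infer_instance

instance : Finite (Outcome S Act Λ) := inferInstanceAs (Finite (Option (Act × Λ × S)))

theorem map_eval_zero_trajMeasure {X : ℕ → Type*} [∀ n, MeasurableSpace (X n)]
    (μ₀ : Measure (X 0)) [IsProbabilityMeasure μ₀]
    (κ : (n : ℕ) → Kernel (Π i : Finset.Iic n, X i) (X (n + 1))) [∀ n, IsMarkovKernel (κ n)] :
    (Kernel.trajMeasure μ₀ κ).map (fun x => x 0) = μ₀ := by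
  have h : (fun x : (Π n, X n) => x 0) =
      (fun y : (Π i : Finset.Iic 0, X i) => y ⟨0, by simp⟩) ∘ Preorder.frestrictLe 0 := rfl
  rw [h, ← Measure.map_map (by fun_prop) (by fun_prop), Kernel.trajMeasure,
    Measure.map_comp _ _ (by fun_prop), Kernel.traj_map_frestrictLe, Kernel.partialTraj_self,
    Measure.id_comp]
  exact (Measure.map_map (measurable_pi_apply _) (MeasurableEquiv.measurable _)).trans
    Measure.map_id

/-- Disintegrating the trajectory measure at time `t` turns a bound on the conditional probability
after every history into a bound on the event. With `c = 0` this yields the almost sure statements;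
with `c < 1` it bounds the syntactic value. -/
theorem Strategy.measure_le (μ : M.Strategy) (s : S) (t : ℕ)
    (B : Set (List (Move S Act Λ) × Outcome S Act Λ)) (c : ℝ≥0∞)
    (hB : ∀ h, (μ.next s h).toMeasure {o | (h, o) ∈ B} ≤ c) :
    μ.measure s {ω | (∀ i < t, ω i ≠ none) ∧ (history t ω, ω t) ∈ B} ≤ c := by
  cases t with
  | zero =>
    refine le_trans (le_of_eq ?_) (hB [])
    rw [← map_eval_zero_trajMeasure (X := fun _ => Outcome S Act Λ) (μ.next s []).toMeasure
      (μ.kernel s), Measure.map_apply (by fun_prop) MeasurableSet.of_discrete]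
    simp [history, Strategy.measure]
  | succ t =>
    let C : Set (((_ : Finset.Iic t) → Outcome S Act Λ) × Outcome S Act Λ) :=
      {p | p.1 ⟨t, Finset.mem_Iic.2 le_rfl⟩ ≠ none ∧
        (List.reduceOption (List.ofFn fun i : Fin (t + 1) =>
          p.1 ⟨i, Finset.mem_Iic.2 (Nat.lt_succ_iff.1 i.2)⟩), p.2) ∈ B}
    have hC : MeasurableSet C := MeasurableSet.of_discrete
    calc μ.measure s {ω | (∀ i < t + 1, ω i ≠ none) ∧ (history (t + 1) ω, ω (t + 1)) ∈ B}
        ≤ μ.measure s ((fun x => (Preorder.frestrictLe t x, x (t + 1))) ⁻¹' C) :=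
          measure_mono fun ω hω => ⟨hω.1 t (Nat.lt_succ_self t), hω.2⟩
      _ = ((μ.measure s).map (fun x => (Preorder.frestrictLe t x, x (t + 1)))) C :=
          (Measure.map_apply (by fun_prop) hC).symm
      _ = (((μ.measure s).map (Preorder.frestrictLe t)) ⊗ₘ μ.kernel s t) C := by
          rw [Strategy.measure]
          exact congrArg (fun m : Measure _ => m C)
            (Kernel.map_frestrictLe_trajMeasure_compProd_eq_map_trajMeasure).symm
      _ = ∫⁻ x, μ.kernel s t x (Prod.mk x ⁻¹' C) ∂((μ.measure s).map (Preorder.frestrictLe t)) :=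
          Measure.compProd_apply hC
      _ ≤ ∫⁻ _, c ∂((μ.measure s).map (Preorder.frestrictLe t)) := by
          refine lintegral_mono fun x => ?_
          -- Once the process has stopped, the kernel no longer follows `next`; such histories lie
          -- outside the event.
          by_cases hx : x ⟨t, Finset.mem_Iic.2 le_rfl⟩ = none
          · have : Prod.mk x ⁻¹' C = ∅ := by
              ext o
              simp [C, hx]
            simp [this]
          · have h1 : μ.kernel s t x = (μ.next s (List.reduceOption (List.ofFn
                fun i : Fin (t + 1) =>
                  x ⟨i, Finset.mem_Iic.2 (Nat.lt_succ_iff.1 i.2)⟩))).toMeasure := by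
              simp only [Strategy.kernel, Kernel.ofFunOfCountable, Kernel.coe_mk, if_neg hx]
            rw [h1]
            refine le_trans (measure_mono fun o ho => ?_) (hB _)
            exact ho.2
      _ = c := by
          have : IsProbabilityMeasure ((μ.measure s).map
              (Preorder.frestrictLe (π := fun _ => Outcome S Act Λ) t)) :=
            Measure.isProbabilityMeasure_map (by fun_prop)
          rw [lintegral_const]
          exact (congrArg (c * ·) measure_univ).trans (mul_one c)

/-- At each time a step of probability zero has conditional probability zero, and there are
countably many times. -/
theorem Strategy.ae_prob_ne_zero (μ : M.Strategy) (s : S) :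
    ∀ᵐ ω ∂μ.measure s, ∀ r : ℕ → Move S Act Λ, (∀ i, ω i = some (r i)) →
      ∀ t, M.prob (stateAt s r t) (r t).1 (r t).2.1 (r t).2.2 ≠ 0 := by
  let B : Set (List (Move S Act Λ) × Outcome S Act Λ) :=
    {p | ∃ y, p.2 = some y ∧ M.prob (lastState s p.1) y.1 y.2.1 y.2.2 = 0}
  have h : ∀ t, ∀ᵐ ω ∂μ.measure s, ¬ ((∀ i < t, ω i ≠ none) ∧ (history t ω, ω t) ∈ B) := by
    intro t
    rw [ae_iff]
    simp only [not_not]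
    refine le_antisymm (μ.measure_le s t B 0 fun h => μ.next_le s h _ 0 fun m _ => ?_) zero_le
    rw [nonpos_iff_eq_zero, PMF.toOuterMeasure_apply_eq_zero_iff, Set.disjoint_left]
    rintro x hx ⟨y, hy, hy0⟩
    rw [PMF.mem_support_iff] at hx
    cases x with
    | none => simp at hy
    | some x =>
      simp only [Option.map_some, Option.some.injEq] at hy
      subst hy
      exact hx (by simpa [stepDist] using hy0)
  filter_upwards [ae_all_iff.2 h] with ω hω r hr t h0
  refine hω t ⟨fun i _ => by simp [hr], r t, hr t, ?_⟩
  rw [lastState_history s hr]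
  exact h0

theorem Strategy.ae_infinite (μ : M.Strategy) (s : S)
    (hM : ∀ s m, M.Available s m → ∑ x : Λ × S, M.prob s m x.1 x.2 = 1) :
    ∀ᵐ ω ∂μ.measure s, ∃ r : ℕ → Move S Act Λ, ∀ i, ω i = some (r i) := by
  have h : ∀ t, ∀ᵐ ω ∂μ.measure s,
      ¬ ((∀ i < t, ω i ≠ none) ∧ (history t ω, ω t) ∈ {p | p.2 = none}) := by
    intro t
    rw [ae_iff]
    simp only [not_not]
    refine le_antisymm (μ.measure_le s t _ 0 fun h => μ.next_le s h _ 0 fun m hm => ?_) zero_le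
    rw [nonpos_iff_eq_zero, PMF.toOuterMeasure_apply_eq_zero_iff, Set.disjoint_left]
    intro x hx hx'
    rw [PMF.mem_support_iff] at hx
    cases x with
    | none => exact hx (by simp [stepDist, hM _ _ hm])
    | some x => simp at hx'
  filter_upwards [ae_all_iff.2 h] with ω hω
  have h1 : ∀ t, ω t ≠ none := by
    intro t
    induction t using Nat.strong_induction_on with
    | _ t ih => exact fun h0 => hω t ⟨ih, h0⟩
  choose r hr using fun i => Option.ne_none_iff_exists'.1 (h1 i)
  exact ⟨r, hr⟩

end MDP

/-! ### Markov chains as MDPs, and their semantic and syntactic values. -/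

open Classical in
/-- The MDP without choices given by a Markov chain with transition function `step`, in which every
transition from `s` has the label `lab s`. -/
noncomputable def chain {S Λ : Type*} [Fintype S] [Fintype Λ] (lab : S → Λ) (step : S → PMF S) :
    MDP S Unit Λ where
  Enabled s _ a := a = lab s
  prob s _ a s' := if a = lab s then (step s s').toNNReal else 0
  prob_eq_zero := by
    intro s m a s' h
    simp [h]
  sum_le_one := by
    intro s m
    rw [Fintype.sum_prod_type, Finset.sum_eq_single (lab s) (by simp +contextual) (by simp)]
    simp only [if_true]
    rw [← ENNReal.coe_le_coe, ENNReal.ofNNReal_finsetSum, ENNReal.coe_one, ← (step s).tsum_coe,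
      tsum_fintype]
    exact Finset.sum_le_sum fun s' _ => ENNReal.coe_toNNReal_le_self
  exists_enabled s := ⟨(), lab s, rfl⟩

section chain

variable {S Λ Q : Type*} [Fintype S] [Fintype Λ] (lab : S → Λ) (step : S → PMF S)

theorem chain_prob_ne_zero {s : S} {m : Unit} {a : Λ} {s' : S}
    (h : (chain lab step).prob s m a s' ≠ 0) : a = lab s ∧ s' ∈ (step s).support := by
  simp only [chain, ne_eq, ite_eq_right_iff, not_forall] at h
  obtain ⟨ha, h⟩ := h
  refine ⟨ha, ?_⟩
  rw [PMF.mem_support_iff]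
  intro h0
  simp [h0] at h

theorem chain_sum_prob (s : S) (m : Unit) :
    ∑ x : Λ × S, (chain lab step).prob s m x.1 x.2 = 1 := by
  simp only [chain]
  rw [Fintype.sum_prod_type, Finset.sum_eq_single (lab s) (by simp +contextual) (by simp)]
  simp only [if_true]
  rw [← ENNReal.coe_inj, ENNReal.ofNNReal_finsetSum, ENNReal.coe_one, ← (step s).tsum_coe,
    tsum_fintype]
  exact Finset.sum_congr rfl fun s' _ => ENNReal.coe_toNNReal (PMF.apply_ne_top _ _)

/-- `x` is an infinite path of the Markov chain that starts in `s`. -/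
def IsPath {S : Type*} (step : S → PMF S) (s : S) (x : ℕ → S) : Prop :=
  x 0 = s ∧ ∀ i, x (i + 1) ∈ (step (x i)).support

variable (A : NBA Λ Q)

theorem one_le_PSem_chain (s : S)
    (hL : ∀ x, IsPath step s x → (fun i => lab (x i)) ∈ A.language) :
    1 ≤ A.PSem (chain lab step) s := by
  let μ : (chain lab step).Strategy :=
    ⟨fun _ _ => PMF.pure (), fun s h m _ => ⟨lab (lastState s h), rfl⟩⟩
  refine le_trans ?_ (le_iSup _ μ)
  have h : ∀ᵐ ω ∂μ.measure s, ω ∈ {ω | ∃ r : ℕ → Move S Unit Λ, (∀ i, ω i = some (r i)) ∧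
      (fun i => (r i).2.1) ∈ A.language} := by
    filter_upwards [μ.ae_prob_ne_zero s, μ.ae_infinite s fun s m _ => chain_sum_prob lab step s m]
      with ω h1 ⟨r, hr⟩
    refine ⟨r, hr, ?_⟩
    have h2 := fun t => chain_prob_ne_zero lab step (h1 r hr t)
    have h3 : (fun i => (r i).2.1) = fun i => lab (MDP.stateAt s r i) :=
      funext fun i => (h2 i).1
    rw [h3]
    exact hL _ ⟨rfl, fun i => (h2 i).2⟩
  have := measure_mono_ae (μ := μ.measure s) (s := Set.univ) (h.mono fun ω hω _ => hω)
  rwa [measure_univ] at this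

variable [Fintype Q]

theorem product_prob_ne_zero {Act : Type*} {M : MDP S Act Λ} {x : S × Q} {u : Act × (Λ → Q)}
    {a : Λ} {y : S × Q} (h : (A.product M).prob x u a y ≠ 0) :
    y.2 ∈ A.trans x.2 a ∧ M.prob x.1 u.1 a y.1 ≠ 0 := by
  simp only [NBA.product, ne_eq, ite_eq_right_iff, not_forall] at h
  exact ⟨h.1.2, h.2⟩

/-- If the automaton state chosen at step `n` always has some successor of `b` that it cannot
handle, then the syntactic satisfaction probability is smaller than one. -/
theorem PSyn_chain_le (s b : S) (n : ℕ) (k : Q → S) (d : ℝ≥0∞)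
    (hd : ∀ q, d ≤ step b (k q))
    (hbad : ∀ x ρ, IsPath step s x → A.IsRun (fun i => lab (x i)) ρ → A.Buchi ρ →
      x n = b ∧ x (n + 1) ≠ k (ρ (n + 1))) :
    A.PSyn (chain lab step) s ≤ 1 - d := by
  classical
  refine iSup_le fun μ => ?_
  -- The only way to win is to draw, at `b`, a successor other than the one that is bad for the
  -- automaton state chosen in the same step.
  let B : Set (List (Move (S × Q) (Unit × (Λ → Q)) Λ) × Outcome (S × Q) (Unit × (Λ → Q)) Λ) :=
    {p | (lastState (s, A.init) p.1).1 = b ∧ ∃ y, p.2 = some y ∧ y.2.2.1 ≠ k y.2.2.2}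
  refine le_trans (measure_mono_ae ?_) (μ.measure_le (s, A.init) n B (1 - d) fun h => ?_)
  · filter_upwards [μ.ae_prob_ne_zero (s, A.init)] with ω h1 ⟨r, hr, ⟨z, hz, hfr⟩⟩
    have h2 := fun t => product_prob_ne_zero A (h1 r hr t)
    have h3 := fun t => chain_prob_ne_zero lab step (h2 t).2
    have h4 := hbad (fun i => (MDP.stateAt (s, A.init) r i).1)
      (fun i => (MDP.stateAt (s, A.init) r i).2) ⟨rfl, fun i => (h3 i).2⟩
      ⟨rfl, fun i => by
        have h5 := (h2 i).1
        rw [(h3 i).1] at h5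
        exact h5⟩
      ⟨z.2, hz, by
        rw [Filter.frequently_atTop] at hfr ⊢
        intro i
        obtain ⟨j, hj, hj'⟩ := hfr i
        -- The product condition looks at the state after step `i`, which is the state at time `i +
        -- 1`.
        exact ⟨j + 1, by omega, congrArg Prod.snd hj'⟩⟩
    refine ⟨fun i _ => by simp [hr], ?_, r n, hr n, h4.2⟩
    rw [MDP.lastState_history _ hr]
    exact h4.1
  · refine μ.next_le _ h _ _ fun m _ => ?_
    by_cases hb : (lastState (s, A.init) h).1 = b
    swap
    · simp [B, hb]
    rw [PMF.toOuterMeasure_apply, tsum_fintype, Fintype.sum_option]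
    obtain ⟨x, hx⟩ : ∃ x, x = lastState (s, A.init) h := ⟨_, rfl⟩
    rw [← hx] at hb ⊢
    -- The action `m` fixes the next automaton state `m.2 (lab b)` before the successor is drawn, so
    -- a single successor is forbidden. An illegal automaton move blocks and only loses mass, hence
    -- an inequality.
    have hle : ∀ y : Λ × (S × Q), ({o : Option (Λ × (S × Q)) |
        o.map (fun y => (m, y)) ∈ {o | (h, o) ∈ B}}.indicator
          (⇑(((A.product (chain lab step)).stepDist x m))) (some y)) ≤
        if y.1 = lab b then (if y.2.2 = m.2 (lab b) then
          (if y.2.1 = k (m.2 (lab b)) then 0 else step b y.2.1) else 0) else 0 := by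
      rintro ⟨a, s', q⟩
      by_cases h1 : (a = lab b ∧ q = m.2 (lab b)) ∧ s' ≠ k (m.2 (lab b))
      · obtain ⟨⟨rfl, rfl⟩, h1⟩ := h1
        refine le_trans (Set.indicator_le_self _ _ _) ?_
        simp only [if_true, if_neg h1]
        simp only [MDP.stepDist, PMF.ofFintype_apply, Option.elim, NBA.product, chain, hb]
        simp only [if_true]
        split_ifs
        · exact ENNReal.coe_toNNReal_le_self
        · simp
      · by_cases h2 : some (a, s', q) ∈ {o : Option (Λ × (S × Q)) |
            o.map (fun y => (m, y)) ∈ {o | (h, o) ∈ B}}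
        · rw [Set.indicator_of_mem h2]
          refine le_trans (le_of_eq ?_) zero_le
          simp only [MDP.stepDist, PMF.ofFintype_apply, Option.elim, NBA.product, chain, hb]
          simp only [B, Set.mem_ofPred_eq, Option.map_some, Option.some.injEq] at h2
          obtain ⟨-, y, rfl, h2⟩ := h2
          simp only [ENNReal.coe_eq_zero, ite_eq_right_iff]
          simp only at h2
          grind
        · rw [Set.indicator_of_notMem h2]
          exact zero_le
    have hnone : ({o : Option (Λ × (S × Q)) |
        o.map (fun y => (m, y)) ∈ {o | (h, o) ∈ B}}.indicator
          (⇑(((A.product (chain lab step)).stepDist x m))) none) = 0 := by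
      simp [B]
    rw [hnone, zero_add]
    refine le_trans (Finset.sum_le_sum fun y _ => hle y) ?_
    have hsum : ∑ y : Λ × (S × Q), (if y.1 = lab b then (if y.2.2 = m.2 (lab b) then
          (if y.2.1 = k (m.2 (lab b)) then 0 else step b y.2.1) else 0) else 0) =
        ∑ s', if s' = k (m.2 (lab b)) then 0 else step b s' := by
      simp [Fintype.sum_prod_type]
    rw [hsum]
    have htot : (∑ s', if s' = k (m.2 (lab b)) then 0 else step b s') +
        step b (k (m.2 (lab b))) = 1 := by
      rw [← (step b).tsum_coe, tsum_fintype,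
        ← Finset.sum_erase_add _ (step b) (Finset.mem_univ (k (m.2 (lab b))))]
      congr 1
      rw [← Finset.sum_erase_add _ _ (Finset.mem_univ (k (m.2 (lab b)))), if_pos rfl, add_zero]
      exact Finset.sum_congr rfl fun s' hs' => if_neg (Finset.ne_of_mem_erase hs')
    rw [ENNReal.eq_sub_of_add_eq (PMF.apply_ne_top _ _) htot]
    exact tsub_le_tsub_left (hd _) 1

end chain

/-! ### Reachable states and languages of states -/

namespace NBA

variable {Λ Q : Type*} (A : NBA Λ Q)

/-- `q` is reachable from the initial state by reading the first `n` letters of `w`. -/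
def Reaches (w : ℕ → Λ) (n : ℕ) (q : Q) : Prop :=
  ∃ ρ : ℕ → Q, ρ 0 = A.init ∧ (∀ i < n, ρ (i + 1) ∈ A.trans (ρ i) (w i)) ∧ ρ n = q

/-- `x` is accepted from the state `q`. -/
def AcceptsFrom (q : Q) (x : ℕ → Λ) : Prop :=
  ∃ ρ : ℕ → Q, ρ 0 = q ∧ (∀ i, ρ (i + 1) ∈ A.trans (ρ i) (x i)) ∧ A.Buchi ρ

variable {A}

theorem AcceptsFrom.mem_language {q : Q} {x w : ℕ → Λ} {n : ℕ} (hx : A.AcceptsFrom q x)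
    (hq : A.Reaches w n q) (hw : ∀ i, w (n + i) = x i) : w ∈ A.language := by
  obtain ⟨ρ, h0, hs, hn⟩ := hq
  obtain ⟨σ, g0, gs, p, hp, hf⟩ := hx
  refine ⟨fun i => if i < n then ρ i else σ (i - n), ⟨?_, fun i => ?_⟩, p, hp, ?_⟩
  · dsimp only
    split_ifs with h
    · exact h0
    · obtain rfl : n = 0 := by omega
      rw [Nat.sub_zero, g0, ← hn, h0]
  · dsimp only
    rcases lt_trichotomy (i + 1) n with h | h | h
    · rw [if_pos h, if_pos (by omega)]
      exact hs i (by omega)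
    · rw [if_neg (show ¬ i + 1 < n by omega), if_pos (show i < n by omega), h, Nat.sub_self, g0,
        ← hn, ← h]
      exact hs i (by omega)
    · rw [if_neg (by omega), if_neg (by omega)]
      obtain ⟨j, rfl⟩ := Nat.exists_eq_add_of_le (show n ≤ i by omega)
      rw [hw, show n + j + 1 - n = j + 1 by omega, Nat.add_sub_cancel_left]
      exact gs j
  · rw [Filter.frequently_atTop] at hf ⊢
    intro i
    obtain ⟨j, hj, rfl⟩ := hf i
    refine ⟨n + j, by omega, ?_⟩
    simp

theorem IsRun.reaches {w : ℕ → Λ} {ρ : ℕ → Q} (h : A.IsRun w ρ) (n : ℕ) :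
    A.Reaches w n (ρ n) :=
  ⟨ρ, h.1, fun i _ => h.2 i, rfl⟩

theorem IsRun.acceptsFrom {w : ℕ → Λ} {ρ : ℕ → Q} (h : A.IsRun w ρ) (hb : A.Buchi ρ) (n : ℕ) :
    A.AcceptsFrom (ρ n) (fun i => w (n + i)) := by
  refine ⟨fun i => ρ (n + i), rfl, fun i => h.2 (n + i), ?_⟩
  obtain ⟨p, hp, hf⟩ := hb
  refine ⟨p, hp, ?_⟩
  rw [Filter.frequently_atTop] at hf ⊢
  intro i
  obtain ⟨j, hj, rfl⟩ := hf (n + i)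
  exact ⟨j - n, by omega, congrArg ρ (by omega)⟩

theorem Reaches.congr {w w' : ℕ → Λ} {n : ℕ} {q : Q} (h : A.Reaches w n q)
    (hw : ∀ i < n, w i = w' i) : A.Reaches w' n q := by
  obtain ⟨ρ, h0, hs, hn⟩ := h
  exact ⟨ρ, h0, fun i hi => hw i hi ▸ hs i hi, hn⟩

/-- An automaton that accepts some word from a sink accepts every word from it. -/
theorem AcceptsFrom.of_isSink {q : Q} {x : ℕ → Λ} (h : A.AcceptsFrom q x) (hq : A.IsSink q)
    (y : ℕ → Λ) : A.AcceptsFrom q y := by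
  obtain ⟨ρ, h0, hs, p, hp, hf⟩ := h
  have hρ : ∀ i, ρ i = q := by
    intro i
    induction i with
    | zero => exact h0
    | succ i ih =>
      have := hs i
      rwa [ih, hq] at this
  obtain ⟨i, hi⟩ := hf.exists
  refine ⟨fun _ => q, rfl, fun i => by rw [hq]; rfl, p, hp, ?_⟩
  rw [← hi, hρ]
  exact Eventually.frequently (Eventually.of_forall fun _ => rfl)

end NBA

/-! ### The words `u x` with `|u| = n` -/

/-- The concatenation of a word of length `n` and an `ω`-word. -/
def prepend {Λ : Type*} {n : ℕ} (u : Fin n → Λ) (x : ℕ → Λ) : ℕ → Λ :=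
  fun i => if h : i < n then u ⟨i, h⟩ else x (i - n)

/-- The `ω`-word `a^j $^ω`. -/
def tail (a : Letter) (j : ℕ) : ℕ → Letter :=
  fun i => if i < j then a else .dollar

section branching

variable {n : ℕ}

/-- The labels of the Markov chain that emits `u` and then `1^j$^ω` for a random `j`. -/
def branchLab (u : Fin n → Letter) : Fin n ⊕ Fin (n + 1) → Letter
  | .inl i => u i
  | .inr j => if (j : ℕ) = 0 then .dollar else .one

/-- The transitions of the Markov chain that emits `u` and then `1^j$^ω` for a random `j ∈ K`. -/
noncomputable def branchStep (K : Finset (Fin (n + 1))) (hK : K.Nonempty) :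
    Fin n ⊕ Fin (n + 1) → PMF (Fin n ⊕ Fin (n + 1))
  | .inl i => if h : (i : ℕ) + 1 < n then PMF.pure (.inl ⟨i + 1, h⟩)
      else (PMF.uniformOfFinset K hK).map .inr
  | .inr j => PMF.pure (.inr ⟨j - 1, by omega⟩)

variable {K : Finset (Fin (n + 1))} {hK : K.Nonempty}

theorem IsPath.branch_inl (hn : 0 < n) {x : ℕ → Fin n ⊕ Fin (n + 1)}
    (hx : IsPath (branchStep K hK) (.inl ⟨0, hn⟩) x) (i : ℕ) (hi : i < n) :
    x i = .inl ⟨i, hi⟩ := by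
  induction i with
  | zero => exact hx.1
  | succ i ih =>
    have := hx.2 i
    rw [ih (by omega)] at this
    simpa [branchStep, hi] using this

theorem IsPath.branch_inr (hn : 0 < n) {x : ℕ → Fin n ⊕ Fin (n + 1)}
    (hx : IsPath (branchStep K hK) (.inl ⟨0, hn⟩) x) :
    ∃ j ∈ K, ∀ i, x (n + i) = .inr ⟨j - i, by omega⟩ := by
  have h := hx.2 (n - 1)
  rw [hx.branch_inl hn (n - 1) (by omega)] at h
  simp only [branchStep, dif_neg (show ¬ (n - 1 + 1 < n) by omega), PMF.mem_support_map_iff,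
    PMF.mem_support_uniformOfFinset_iff] at h
  obtain ⟨j, hj, h⟩ := h
  rw [Nat.sub_add_cancel hn] at h
  refine ⟨j, hj, fun i => ?_⟩
  induction i with
  | zero => exact h.symm
  | succ i ih =>
    have := hx.2 (n + i)
    rw [ih] at this
    simpa [branchStep, Nat.sub_sub, add_assoc] using this

theorem IsPath.branchLab_eq (hn : 0 < n) (u : Fin n → Letter) {x : ℕ → Fin n ⊕ Fin (n + 1)}
    (hx : IsPath (branchStep K hK) (.inl ⟨0, hn⟩) x) :
    ∃ j ∈ K, x n = .inr j ∧ (fun i => branchLab u (x i)) = prepend u (tail .one j) := by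
  obtain ⟨j, hj, h⟩ := hx.branch_inr hn
  refine ⟨j, hj, by simpa using h 0, ?_⟩
  funext i
  by_cases hi : i < n
  · simp [prepend, hi, hx.branch_inl hn i hi, branchLab]
  · obtain ⟨m, rfl⟩ := Nat.exists_eq_add_of_le (not_lt.1 hi)
    simp only [h, branchLab, prepend, hi, tail, dite_false, Nat.add_sub_cancel_left]
    split_ifs <;> first | rfl | omega

/-- A good-for-MDPs automaton can read `u` in such a way that all continuations `1^j$^ω` that lead
to an accepted word are accepted from the state that is reached. -/
theorem exists_reaches_acceptsFrom {Q : Type*} [Fintype Q] {A : NBA Letter Q}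
    (hA : A.GoodForMDPs) (hn : 0 < n) (u : Fin n → Letter) (K : Finset (Fin (n + 1)))
    (hK : K.Nonempty) (hL : ∀ j ∈ K, prepend u (tail .one j) ∈ A.language) :
    ∃ q, (∀ x, A.Reaches (prepend u x) n q) ∧ ∀ j ∈ K, A.AcceptsFrom q (tail .one j) := by
  by_contra hcon
  have hbad : ∀ q, ∃ j ∈ K, (∀ x, A.Reaches (prepend u x) n q) →
      ¬ A.AcceptsFrom q (tail .one j) := by
    intro q
    by_cases h : ∀ x, A.Reaches (prepend u x) n q
    · by_contra! h'
      exact hcon ⟨q, h, fun j hj => (h' j hj).2⟩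
    -- For a state not reachable on `u` any element of `K` will do.
    · exact ⟨_, hK.choose_spec, fun h' => absurd h' h⟩
  choose k hkK hk using hbad
  have h1 := one_le_PSem_chain (branchLab u) (branchStep K hK) A (.inl ⟨0, hn⟩) fun x hx => by
    obtain ⟨j, hj, -, hx⟩ := hx.branchLab_eq hn u
    rw [hx]
    exact hL j hj
  rw [← hA] at h1
  have h2 := PSyn_chain_le (branchLab u) (branchStep K hK) A (.inl ⟨0, hn⟩)
    -- Step `n - 1` emits the last letter of `u` and draws `j`, while the automaton moves to its
    -- state at time `n`.
    (.inl ⟨n - 1, by omega⟩) (n - 1) (fun q => .inr (k q)) ((K.card : ℝ≥0∞)⁻¹)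
    (fun q => by
      simp only [branchStep, dif_neg (show ¬ (n - 1 + 1 < n) by omega), PMF.map_apply]
      refine le_trans (le_of_eq ?_) (ENNReal.le_tsum (k q))
      simp [PMF.uniformOfFinset_apply, hkK])
    (fun x ρ hx hρ hb => by
      refine ⟨hx.branch_inl hn _ _, ?_⟩
      rw [Nat.sub_add_cancel hn]
      obtain ⟨j, hj, hxn, hx⟩ := hx.branchLab_eq hn u
      rw [hxn]
      intro hjk
      rw [Sum.inr.injEq] at hjk
      refine hk (ρ n) (fun y => ?_) ?_
      · refine (hρ.reaches n).congr fun i hi => ?_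
        rw [show branchLab u (x i) = _ from congrFun hx i]
        simp [prepend, hi]
      · have := hρ.acceptsFrom hb n
        rw [← hjk]
        convert this using 2 with i
        rw [show branchLab u (x (n + i)) = _ from congrFun hx (n + i)]
        simp [prepend])
  have h3 : (1 : ℝ≥0∞) - (K.card : ℝ≥0∞)⁻¹ < 1 :=
    ENNReal.sub_lt_self ENNReal.one_ne_top one_ne_zero (by simp)
  exact absurd (h1.trans h2) (not_le.2 h3)

end branching

/-! ### Membership in the languages -/

theorem mem_lang_of {n p : ℕ} (hn : 0 < n) (hnp : n ≤ p) {y : ℕ → Letter}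
    (hbit : ∀ i < p, (y i).IsBit) (hone : y (p - n) = .one) (hdollar : y p = .dollar) :
    (List.ofFn fun i : Fin (p + 1) => y i) ∈ lang n := by
  refine ⟨List.ofFn fun i : Fin (p - n) => y i, List.ofFn fun i : Fin (n - 1) => y (p - n + 1 + i),
    ?_, ?_, ?_, ?_⟩
  · intro a ha
    obtain ⟨i, rfl⟩ := List.mem_ofFn.1 ha
    exact hbit _ (by omega)
  · intro a ha
    obtain ⟨i, rfl⟩ := List.mem_ofFn.1 ha
    exact hbit _ (by omega)
  · simp; omega
  · refine List.ext_getElem (by simp; omega) fun i h1 h2 => ?_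
    simp only [List.getElem_ofFn, List.getElem_append, List.length_append, List.length_ofFn,
      List.length_singleton, List.getElem_singleton]
    split_ifs with h3 h4 h5
    · rfl
    · rw [← hone]; congr 1; omega
    · congr 1; omega
    · rw [← hdollar]
      simp only [List.length_ofFn] at h1
      congr 1; omega

theorem concat_ofFn {Λ : Type*} (y : ℕ → Λ) (p : ℕ) :
    concat (List.ofFn fun i : Fin p => y i) (fun i => y (p + i)) = y := by
  funext i
  simp only [concat, List.length_ofFn, List.getElem_ofFn]
  split_ifs with h
  · rfl
  · congr 1; omega

/-- Membership of words `w$^ω` with `w ∈ {0,1}*` in the two languages. -/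
theorem mem_of_dollar {n p : ℕ} (hn : 0 < n) (hnp : n ≤ p) {y : ℕ → Letter}
    (hbit : ∀ i < p, (y i).IsBit) (hdollar : ∀ i, p ≤ i → y i = .dollar)
    (hone : y (p - n) = .one) : y ∈ langR n ∧ y ∈ langS n := by
  have h := mem_lang_of hn hnp hbit hone (hdollar p le_rfl)
  refine ⟨⟨_, h, fun i => y (p + 1 + i), (concat_ofFn y (p + 1)).symm⟩,
    Or.inl ⟨_, h, ?_⟩⟩
  have : (fun _ : ℕ => Letter.dollar) = fun i => y (p + 1 + i) :=
    funext fun i => (hdollar _ (by omega)).symm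
  rw [this, concat_ofFn]

/-- Both `p` and the end of `w` are the position of the first `$` in `y`, so they coincide. -/
theorem eq_one_of_concat {n p : ℕ} {y x : ℕ → Letter} (hbit : ∀ i < p, (y i).IsBit)
    (hdollar : y p = .dollar) {w : List Letter} (hw : w ∈ lang n) (hy : y = concat w x) :
    y (p - n) = .one := by
  obtain ⟨u, v, hu, hv, rfl, rfl⟩ := hw
  have hlen : (u ++ [Letter.one] ++ v ++ [Letter.dollar]).length = u.length + v.length + 2 := by
    simp; omega
  have h1 : y (u.length + v.length + 1) = .dollar := by
    rw [hy, concat, dif_pos (by omega)]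
    rw [List.getElem_append_right (by simp; omega)]
    simp
  have h2 : y u.length = .one := by
    rw [hy, concat, dif_pos (by omega)]
    simp
  have h3 : ∀ i < u.length + v.length + 1, (y i).IsBit := by
    intro i hi
    rw [hy, concat, dif_pos (by omega)]
    rw [List.getElem_append_left (by simp; omega)]
    have hm := List.getElem_mem (l := u ++ [Letter.one] ++ v) (n := i) (by simp; omega)
    simp only [List.mem_append, List.mem_singleton] at hm
    rcases hm with (hm | hm) | hm
    · exact hu _ hm
    · exact Or.inr hm
    · exact hv _ hm
  have hp : p = u.length + v.length + 1 := by
    rcases lt_trichotomy p (u.length + v.length + 1) with h | h | h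
    · have := h3 p h
      rw [hdollar] at this
      simp [Letter.IsBit] at this
    · exact h
    · have := hbit _ h
      rw [h1] at this
      simp [Letter.IsBit] at this
  rw [hp, show u.length + v.length + 1 - (v.length + 1) = u.length by omega, h2]

theorem eq_one_of_mem {n p : ℕ} {y : ℕ → Letter} (hbit : ∀ i < p, (y i).IsBit)
    (hdollar : y p = .dollar) (hy : y ∈ langR n ∨ y ∈ langS n) : y (p - n) = .one := by
  rcases hy with ⟨w, hw, x, rfl⟩ | ⟨w, hw, rfl⟩ | hy
  · exact eq_one_of_concat hbit hdollar hw rfl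
  · exact eq_one_of_concat hbit hdollar hw rfl
  · have := hy p
    rw [hdollar] at this
    simp [Letter.IsBit] at this

theorem prepend_tail_bit {n : ℕ} {u : Fin n → Letter} (hu : ∀ i, (u i).IsBit) {a : Letter}
    (ha : a.IsBit) (j : ℕ) : ∀ i < n + j, (prepend u (tail a j) i).IsBit := by
  intro i hi
  simp only [prepend, tail]
  split_ifs
  · exact hu _
  · exact ha
  · omega

theorem prepend_tail_dollar {n : ℕ} (u : Fin n → Letter) (a : Letter) (j : ℕ) :
    ∀ i, n + j ≤ i → prepend u (tail a j) i = .dollar := by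
  intro i hi
  simp only [prepend, tail]
  rw [dif_neg (by omega), if_neg (by omega)]

/-! ### Distinct non-sink states for the words of length `n`. -/

theorem two_pow_le_card_not_isSink {Q : Type*} [Fintype Q] (A : NBA Letter Q)
    (hA : A.GoodForMDPs) {n : ℕ} (hL : A.language = langR n ∨ A.language = langS n)
    (hn : 0 < n) : 2 ^ n ≤ Nat.card {q : Q // ¬ A.IsSink q} := by
  classical
  have hmem : ∀ {y : ℕ → Letter}, y ∈ langR n ∧ y ∈ langS n → y ∈ A.language := by
    rintro y ⟨h1, h2⟩
    rcases hL with h | h <;> rwa [h]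
  have hmem' : ∀ {y : ℕ → Letter}, y ∈ A.language → y ∈ langR n ∨ y ∈ langS n := by
    intro y hy
    rcases hL with h | h <;> rw [h] at hy <;> simp [hy]
  let u : (Fin n → Bool) → Fin n → Letter := fun b i => if b i then .one else .zero
  have hu : ∀ b i, (u b i).IsBit := fun b i => by
    by_cases h : b i <;> simp [u, h, Letter.IsBit]
  have hone : Letter.one.IsBit := Or.inr rfl
  have hzero : Letter.zero.IsBit := Or.inl rfl
  have hex : ∀ b, ∃ q, (∀ x, A.Reaches (prepend (u b) x) n q) ∧
      ∀ j : Fin (n + 1), prepend (u b) (tail .one j) ((j : ℕ)) = .one →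
        A.AcceptsFrom q (tail .one j) := by
    intro b
    have := exists_reaches_acceptsFrom hA hn (u b)
      (Finset.univ.filter fun j : Fin (n + 1) => prepend (u b) (tail .one j) ((j : ℕ)) = .one)
      -- The index `j = n` always qualifies: the letter at position `n` is the first `1` after `u`.
      ⟨Fin.last n, by simp [prepend, tail, hn.ne']⟩ fun j hj => by
        refine hmem (mem_of_dollar hn (Nat.le_add_right n j) (prepend_tail_bit (hu b) hone j)
          (prepend_tail_dollar _ _ j) ?_)
        rw [Nat.add_sub_cancel_left]
        exact (Finset.mem_filter.1 hj).2
    obtain ⟨q, h1, h2⟩ := this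
    exact ⟨q, h1, fun j hj => h2 j (by simp [hj])⟩
  choose q hreach hacc using hex
  have hsink : ∀ b, ¬ A.IsSink (q b) := by
    intro b hb
    have h1 := hacc b (Fin.last n) (by simp [prepend, tail, hn])
    have h2 := (h1.of_isSink hb (tail .zero n)).mem_language (hreach b (tail .zero n))
      (fun i => by simp [prepend])
    have h3 := eq_one_of_mem (prepend_tail_bit (hu b) hzero n)
      (prepend_tail_dollar (u b) .zero n _ le_rfl) (hmem' h2)
    simp [prepend, tail, hn] at h3
  -- The continuation `1^i$^ω` tests exactly the letter `i` of the word read before it.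
  have hle : ∀ b b', q b = q b' → ∀ i, b i = true → b' i = true := by
    intro b b' h i hi
    have h1 := hacc b ⟨i, by omega⟩ (by simp [prepend, u, hi])
    rw [h] at h1
    have h2 := h1.mem_language (hreach b' (tail .one i)) (fun i => by simp [prepend])
    have h3 := eq_one_of_mem (prepend_tail_bit (hu b') hone i)
      (prepend_tail_dollar (u b') .one i _ le_rfl) (hmem' h2)
    by_contra hi'
    simp [prepend, u, hi'] at h3
  have hinj : Function.Injective fun b => (⟨q b, hsink b⟩ : {q : Q // ¬ A.IsSink q}) := by
    intro b b' h
    have h' : q b = q b' := congrArg Subtype.val h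
    funext i
    exact Bool.eq_iff_iff.2 ⟨hle b b' h' i, hle b' b h'.symm i⟩
  have := Nat.card_le_card_of_injective _ hinj
  simpa using this

end GfM

theorem mainTheorem2 {Q : Type*} [Fintype Q] (A : GfM.NBA GfM.Letter Q) (hA : A.GoodForMDPs)
    (n : ℕ) (hL : A.language = GfM.langR n ∨ A.language = GfM.langS n) :
    2 ^ n ≤ Nat.card Q ∧ (0 < n → 2 ^ n ≤ Nat.card {q : Q // ¬ A.IsSink q}) := by
  have h : 0 < n → 2 ^ n ≤ Nat.card {q : Q // ¬ A.IsSink q} :=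
    GfM.two_pow_le_card_not_isSink A hA hL
  refine ⟨?_, h⟩
  rcases Nat.eq_zero_or_pos n with rfl | hn
  -- For `n = 0` the bound is `1`, met by the initial state.
  · have : Nonempty Q := ⟨A.init⟩
    exact Nat.card_pos
  · exact (h hn).trans (Nat.card_le_card_of_injective _ Subtype.val_injective)
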